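/- Consider a fully efficient battery ($\eta_c=\eta_d=1$) of capacity $B_{\max}\ge 0$. Time is slotted. The exogenous state is a Markov chain $(X_t)_{t\ge 0}$ on $\Omega=\mathcal D\times\mathcal P\times\mathcal M$, where $\mathcal D\subseteq[0,\infty)$ (demands) and $\mathcal P\subseteq\mathbb R$ (prices) are nonempty compact sets and $\mathcal M$ is a nonempty measurable space of modulating states; $d(x)$ and $p(x)$ denote the demand and the price in state $x$. Let $\bar A_c,\bar A_d\ge 0$ be charging and discharging limits, functions of the battery level on $[0,B_{\max}]$. In state $x$ and at battery level $b\in[0,B_{\max}]$ the next battery level $\beta$ must be chosen in $U_x(b)=[U_x^-(b),U^+(b)]$, where $$U_x^-(b)=\max\{0,\,b-d(x),\,b-\bar A_d(b)\},\qquad U^+(b)=\min\{B_{\max},\,b+\bar A_c(b)\},$$ at the cost $\gamma_x(\beta-b)=(d(x)+\beta-b)\,p(x)$. Assume that for every $x\in\Omega$ the set $\{(b,\beta): b\in[0,B_{\max}],\ \beta\in U_x(b)\}$ is convex and closed (for instance, $\bar A_c$ and $\bar A_d$ are concave and continuous). Let $0<\alpha<1$, let $J_x(b)$ be the infimum, over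 all nonanticipative measurable feasible operations of the battery, of the expected total discounted cost $\mathbb E\sum_{t\ge 0}\alpha^t g(t)$ from initial state $x$ and level $b$, where $g(t)$ is the cost in slot $t$, and let $G_x(\beta)=\mathbb E[J_{X_1}(\beta)\mid X_0=x]$. Let $\partial G_x(\beta)$ be the subdifferential of $G_x$ as a function on $[0,B_{\max}]$. A threshold $\beta_x$ in state $x$ is any element of $[\beta_{1,x},\beta_{2,x}]$, where $$\beta_{1,x}=\min\{\beta\in[0,B_{\max}]:\ p(x)+\alpha g\ge 0\text{ for some }g\in\partial G_x(\beta)\},$$ $$\beta_{2,x}=\max\{\beta\in[0,B_{\max}]:\ p(x)+\alpha g\le 0\text{ for some }g\in\partial G_x(\beta)\},$$ with $\beta_{1,x}=B_{\max}$, respectively $\beta_{2,x}=0$, if the set in question is empty. Assume that prices and demands are i.i.d. across time, i.e. the conditional law of $(d(X_{t+1}),p(X_{t+1}))$ given $X_t=x$ is the same for all $x\in\Omega$. Then: (1) every state has a threshold; (2) the set of thresholds in state $x$ depends on $x$ only through the price $p(x)$; (3) the threshold is non-increasing in the price: if $p\mapsto\beta_p$ is any function on $\mathcal P$ such that $\beta_{p(x)}$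 is a threshold in state $x$ for every $x\in\Omega$, then $\beta_p\ge\beta_q$ whenever $p\le q$. Moreover, these are thresholds of an optimal policy: for every initial state and every initial level in $[0,B_{\max}]$, the stationary policy that in state $x$ moves the level $b$ to $\min\{\beta_{p(x)},U^+(b)\}$ if $b\le\beta_{p(x)}$ and to $\max\{\beta_{p(x)},U_x^-(b)\}$ otherwise minimizes the expected total discounted cost. -/

import Mathlib

open MeasureTheory ProbabilityTheory Set

noncomputable section

/-- Data of the storage problem: a battery of capacity `Bmax` with charging and discharging
efficiencies `ηc`, `ηd` and level-dependent rate limits `Ac`, `Ad`; a discount factor `α`;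
compact sets `D` of demands and `P` of prices; modulating states `M`; and the transition law
`κ` of the exogenous Markov chain on `D × P × M` (not required to have a density). -/
structure StorageModel (M : Type*) [MeasurableSpace M] where
  Bmax : ℝ
  Bmax_nonneg : 0 ≤ Bmax
  ηc : ℝ
  ηc_mem : ηc ∈ Ioc (0 : ℝ) 1
  ηd : ℝ
  ηd_mem : ηd ∈ Ioc (0 : ℝ) 1
  Ac : ℝ → ℝ
  Ac_nonneg : ∀ b ∈ Icc 0 Bmax, 0 ≤ Ac b
  Ad : ℝ → ℝ
  Ad_nonneg : ∀ b ∈ Icc 0 Bmax, 0 ≤ Ad b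
  α : ℝ
  α_mem : α ∈ Ioo (0 : ℝ) 1
  D : Set ℝ
  D_nonempty : D.Nonempty
  D_compact : IsCompact D
  D_nonneg : ∀ r ∈ D, 0 ≤ r
  P : Set ℝ
  P_nonempty : P.Nonempty
  P_compact : IsCompact P
  κ : Kernel (D × P × M) (D × P × M)
  markov : IsMarkovKernel κ

namespace StorageModel

variable {M : Type*} [MeasurableSpace M] (S : StorageModel M)

/-- The exogenous state space: demand, price, modulating state. -/
abbrev State : Type _ := S.D × S.P × M

instance : IsMarkovKernel S.κ := S.markov

/-- Demand in a state. -/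
def demand (x : S.State) : ℝ := (x.1 : ℝ)

/-- Price in a state. -/
def price (x : S.State) : ℝ := (x.2.1 : ℝ)

/-- Immediate cost in state `x` when the battery level changes by `δ`. -/
def stageCost (x : S.State) (δ : ℝ) : ℝ :=
  (S.demand x + S.ηc⁻¹ * max δ 0 - S.ηd * max (-δ) 0) * S.price x

/-- Lowest battery level reachable in one slot: the battery cannot go below zero, deliver more
than the demand, or discharge faster than its rate limit. -/
def lowerEnd (x : S.State) (b : ℝ) : ℝ :=
  max 0 (max (b - S.demand x / S.ηd) (b - S.Ad b))

/-- Highest battery level reachable in one slot. -/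
def upperEnd (b : ℝ) : ℝ := min S.Bmax (b + S.ηc * S.Ac b)

/-- Feasible next battery levels. -/
def control (x : S.State) (b : ℝ) : Set ℝ := Icc (S.lowerEnd x b) (S.upperEnd b)

/-- Law of the whole exogenous trajectory of the chain started in `x`. -/
def pathLaw (x : S.State) : Measure (ℕ → S.State) :=
  Kernel.traj (X := fun _ => S.State)
    (fun n => S.κ.comap (fun h : (i : Finset.Iic n) → S.State => h ⟨n, by simp⟩)
      (measurable_pi_apply _)) 0 (fun _ => x)

/-- A nonanticipative feasible battery operation from level `b`: `B t ω` is the battery level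
at time `t`, and `B (t + 1)` is a function of the exogenous states at times `0, …, t`. -/
structure Admissible (b : ℝ) (B : ℕ → (ℕ → S.State) → ℝ) : Prop where
  init : ∀ ω, B 0 ω = b
  adapted : ∀ t, Measurable[Filtration.piLE (X := fun _ : ℕ => S.State) t] (B (t + 1))
  feasible : ∀ t ω, B (t + 1) ω ∈ S.control (ω t) (B t ω)

/-- Expected total discounted cost of the operation `B` when the chain starts in `x`. -/
def cost (x : S.State) (B : ℕ → (ℕ → S.State) → ℝ) : ℝ :=
  ∫ ω, ∑' t : ℕ, S.α ^ t * S.stageCost (ω t) (B (t + 1) ω - B t ω) ∂(S.pathLaw x)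

/-- `B` solves the cost minimization problem from state `x` and battery level `b`. -/
def IsOptimal (x : S.State) (b : ℝ) (B : ℕ → (ℕ → S.State) → ℝ) : Prop :=
  S.Admissible b B ∧ ∀ B', S.Admissible b B' → S.cost x B ≤ S.cost x B'

/-- Minimal expected total discounted cost `J_x(b)`. -/
def J (x : S.State) (b : ℝ) : ℝ := sInf {c | ∃ B, S.Admissible b B ∧ c = S.cost x B}

/-- Expected minimal future cost `G_x(β)` when the next battery level is `β`. -/
def G (x : S.State) (β : ℝ) : ℝ := ∫ y, S.J y β ∂(S.κ x)

/-- Subdifferential at `β` of `G_x` as a function on `[0, Bmax]`. -/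
def subdiffG (x : S.State) (β : ℝ) : Set ℝ :=
  {g | ∀ β' ∈ Icc 0 S.Bmax, S.G x β + g * (β' - β) ≤ S.G x β'}

/-- Levels at which `c + α g ≥ 0` for some (equivalently, for the largest) subgradient `g`. -/
def setOne (x : S.State) (c : ℝ) : Set ℝ :=
  {β ∈ Icc 0 S.Bmax | ∃ g ∈ S.subdiffG x β, 0 ≤ c + S.α * g}

/-- Levels at which `c + α g ≤ 0` for some (equivalently, for the smallest) subgradient `g`. -/
def setTwo (x : S.State) (c : ℝ) : Set ℝ :=
  {β ∈ Icc 0 S.Bmax | ∃ g ∈ S.subdiffG x β, c + S.α * g ≤ 0}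

open Classical in
/-- Smallest threshold for the marginal price `c`. -/
def endOne (x : S.State) (c : ℝ) : ℝ :=
  if (S.setOne x c).Nonempty then sInf (S.setOne x c) else S.Bmax

open Classical in
/-- Largest threshold for the marginal price `c`. -/
def endTwo (x : S.State) (c : ℝ) : ℝ :=
  if (S.setTwo x c).Nonempty then sSup (S.setTwo x c) else 0

/-- The possible charging thresholds `β⁻` in state `x`. -/
def chargingThresholds (x : S.State) : Set ℝ :=
  Icc (S.endOne x (S.ηc⁻¹ * S.price x)) (S.endTwo x (S.ηc⁻¹ * S.price x))

/-- The possible discharging thresholds `β⁺` in state `x`. -/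
def dischargingThresholds (x : S.State) : Set ℝ :=
  Icc (S.endOne x (S.ηd * S.price x)) (S.endTwo x (S.ηd * S.price x))

/-- `β` is a common charging and discharging threshold in state `x`. -/
def IsThreshold (x : S.State) (β : ℝ) : Prop :=
  β ∈ S.chargingThresholds x ∧ β ∈ S.dischargingThresholds x

open Classical in
/-- Next battery level under the two-threshold rule: charge towards `βlo` when below it,
discharge towards `βhi` when above it, otherwise keep the level. -/
def thresholdAction (x : S.State) (βlo βhi b : ℝ) : ℝ :=
  if b ≤ βlo then min βlo (S.upperEnd b)
  else if βhi ≤ b then max βhi (S.lowerEnd x b)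
  else b

/-- Battery levels from `b` under the stationary policy with thresholds `βlo x`, `βhi x`. -/
def thresholdPath (βlo βhi : S.State → ℝ) (b : ℝ) : ℕ → (ℕ → S.State) → ℝ
  | 0, _ => b
  | t + 1, ω =>
    S.thresholdAction (ω t) (βlo (ω t)) (βhi (ω t)) (thresholdPath βlo βhi b t ω)

/-- Prices and demands are i.i.d. across time: whatever the current state, the next
(demand, price) pair has one and the same law. -/
def IIDDemandPrice : Prop :=
  ∀ x x' : S.State, (S.κ x).map (fun y => (S.demand y, S.price y)) =
    (S.κ x').map (fun y => (S.demand y, S.price y))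

/-- In each state, the set of feasible pairs (current level, next level) is convex and closed;
for instance when `Ac` and `Ad` are concave and continuous on `[0, Bmax]`. -/
def ConvexControl : Prop :=
  ∀ x : S.State,
    Convex ℝ {q : ℝ × ℝ | q.1 ∈ Icc 0 S.Bmax ∧ q.2 ∈ S.control x q.1} ∧
    IsClosed {q : ℝ × ℝ | q.1 ∈ Icc 0 S.Bmax ∧ q.2 ∈ S.control x q.1}

end StorageModel

end

/-!
When prices and demands are i.i.d., the expectation of the next value function does not depend on
the current state, so the dynamic programming equation closes on one convex function `f` of the
battery level, obtained as the fixed point of a contraction. For an efficient battery, moving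
energy into the battery is priced linearly, hence the level `a` is chosen to minimize
`p * a + α * f a`, and these minimizers decrease with `p`. By convexity, when the minimizer is out
of reach the best feasible level is the one closest to it, which is what the threshold policy
picks. Along any policy the discounted values `α ^ n * bellman f (X n) (B n)` telescope, so its cost
exceeds `bellman f x b` by the discounted sum of its one-step losses, and the threshold policy has
no such loss. Therefore `J = bellman f` and `G x = f`, and the thresholds are exactly the minimizers
of `p * a + α * f a`.
-/

noncomputable section

section ConvexAnalysis

variable {s : Set ℝ} {f : ℝ → ℝ} {l u : ℝ}

theorem le_chord_of_convexOn (hf : ConvexOn ℝ s f) {c e b : ℝ}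
    (hc : c ∈ s) (he : e ∈ s) (hb : b ∈ segment ℝ c e) :
    f b ≤ f c + (b - c) / (e - c) * (f e - f c) := by
  obtain rfl | hne := eq_or_ne c e
  · simp_all
  obtain ⟨r, t, hr, ht, hrt, rfl⟩ := hb
  have hslope : (r • c + t • e - c) / (e - c) = t := by
    rw [div_eq_iff (sub_ne_zero.2 hne.symm)]
    simp only [smul_eq_mul]
    linear_combination c * hrt
  refine (hf.2 hc he hr ht hrt).trans_eq ?_
  rw [hslope]
  simp only [smul_eq_mul]
  linear_combination f c * hrt

theorem upperSemicontinuousWithinAt_segment_of_convexOn (hf : ConvexOn ℝ s f) {c e : ℝ}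
    (hc : c ∈ s) (he : e ∈ s) : UpperSemicontinuousWithinAt f (segment ℝ c e) c := by
  intro y hy
  have hchord : ContinuousAt (fun b => f c + (b - c) / (e - c) * (f e - f c)) c := by fun_prop
  filter_upwards [nhdsWithin_le_nhds (hchord.eventually_lt_const (by simpa using hy)),
    self_mem_nhdsWithin] with b hlt hb
  exact (le_chord_of_convexOn hf hc he hb).trans_lt hlt

theorem upperSemicontinuousOn_Icc_of_convexOn (hf : ConvexOn ℝ (Icc l u) f) :
    UpperSemicontinuousOn f (Icc l u) := by
  intro c hc y hy
  have hlu := hc.1.trans hc.2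
  rw [← Icc_union_Icc_eq_Icc hc.1 hc.2, nhdsWithin_union, Filter.eventually_sup,
    ← segment_eq_Icc hc.1, ← segment_eq_Icc hc.2, segment_symm]
  exact ⟨upperSemicontinuousWithinAt_segment_of_convexOn hf hc (left_mem_Icc.2 hlu) y hy,
    upperSemicontinuousWithinAt_segment_of_convexOn hf hc (right_mem_Icc.2 hlu) y hy⟩

theorem continuousOn_Icc_of_convex_of_isClosed_epigraph
    (hconv : Convex ℝ {q : ℝ × ℝ | q.1 ∈ Icc l u ∧ f q.1 ≤ q.2})
    (hclosed : IsClosed {q : ℝ × ℝ | q.1 ∈ Icc l u ∧ f q.1 ≤ q.2}) :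
    ContinuousOn f (Icc l u) :=
  continuousOn_iff_lower_upperSemicontinuousOn.2
    ⟨(lowerSemicontinuousOn_iff_isClosed_epigraph isClosed_Icc).2 hclosed,
      upperSemicontinuousOn_Icc_of_convexOn (convexOn_iff_convex_epigraph.2 hconv)⟩

variable {φ ψ : ℝ → ℝ}

open scoped Pointwise in
theorem continuousOn_lower_boundary (hle : ∀ b ∈ Icc l u, φ b ≤ ψ b)
    (hconv : Convex ℝ {q : ℝ × ℝ | q.1 ∈ Icc l u ∧ q.2 ∈ Icc (φ q.1) (ψ q.1)})
    (hcompact : IsCompact {q : ℝ × ℝ | q.1 ∈ Icc l u ∧ q.2 ∈ Icc (φ q.1) (ψ q.1)}) :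
    ContinuousOn φ (Icc l u) := by
  have hepi : {q : ℝ × ℝ | q.1 ∈ Icc l u ∧ φ q.1 ≤ q.2} =
      {q : ℝ × ℝ | q.1 ∈ Icc l u ∧ q.2 ∈ Icc (φ q.1) (ψ q.1)} + {(0 : ℝ)} ×ˢ Ici (0 : ℝ) := by
    ext ⟨b, a⟩
    simp only [mem_ofPred_eq, Set.mem_add, mem_prod, mem_singleton_iff, mem_Ici]
    constructor
    · rintro ⟨hb, ha⟩
      exact ⟨(b, φ b), ⟨hb, le_rfl, hle b hb⟩, (0, a - φ b), ⟨rfl, sub_nonneg.2 ha⟩, by simp⟩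
    · rintro ⟨⟨b', a'⟩, ⟨hb, ha, -⟩, ⟨z, t⟩, ⟨rfl, ht⟩, hsum⟩
      obtain ⟨rfl, rfl⟩ : b' = b ∧ a' + t = a := by simpa using hsum
      exact ⟨hb, le_add_of_le_of_nonneg ha ht⟩
  apply continuousOn_Icc_of_convex_of_isClosed_epigraph <;> rw [hepi]
  · exact hconv.add ((convex_singleton 0).prod (convex_Ici 0))
  · exact (isClosed_singleton.prod isClosed_Ici).add_left_of_isCompact hcompact

theorem continuousOn_upper_boundary (hle : ∀ b ∈ Icc l u, φ b ≤ ψ b)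
    (hconv : Convex ℝ {q : ℝ × ℝ | q.1 ∈ Icc l u ∧ q.2 ∈ Icc (φ q.1) (ψ q.1)})
    (hcompact : IsCompact {q : ℝ × ℝ | q.1 ∈ Icc l u ∧ q.2 ∈ Icc (φ q.1) (ψ q.1)}) :
    ContinuousOn ψ (Icc l u) := by
  let flip : ℝ × ℝ →ₗ[ℝ] ℝ × ℝ := LinearMap.prodMap LinearMap.id (-LinearMap.id)
  have hflip : {q : ℝ × ℝ | q.1 ∈ Icc l u ∧ q.2 ∈ Icc (-ψ q.1) (-φ q.1)} =
      flip '' {q : ℝ × ℝ | q.1 ∈ Icc l u ∧ q.2 ∈ Icc (φ q.1) (ψ q.1)} := by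
    ext ⟨b, a⟩
    constructor
    · rintro ⟨hb, ha⟩
      exact ⟨(b, -a), ⟨hb, le_neg.2 ha.2, neg_le.2 ha.1⟩, by simp [flip]⟩
    · rintro ⟨⟨b', a'⟩, ⟨hb, ha⟩, hq⟩
      obtain ⟨rfl, rfl⟩ : b' = b ∧ -a' = a := by simpa [flip] using hq
      exact ⟨hb, neg_le_neg ha.2, neg_le_neg ha.1⟩
  have hneg : ContinuousOn (fun b => -ψ b) (Icc l u) :=
    continuousOn_lower_boundary (fun b hb => neg_le_neg (hle b hb))
      (hflip ▸ hconv.linear_image flip)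
      (hflip ▸ hcompact.image (continuous_fst.prodMk continuous_snd.neg))
  exact hneg.neg.congr fun b _ => (neg_neg (ψ b)).symm

theorem convexOn_of_isLeast_fiber {E F : Type*} [AddCommGroup E] [Module ℝ E] [AddCommGroup F]
    [Module ℝ F] {s : Set E} {R : Set (E × F)} {L : E × F → ℝ} {v : E → ℝ}
    (hs : Convex ℝ s) (hL : ConvexOn ℝ R L)
    (hv : ∀ b ∈ s, IsLeast {c | ∃ a, (b, a) ∈ R ∧ L (b, a) = c} (v b)) : ConvexOn ℝ s v := by
  refine ⟨hs, fun b₁ hb₁ b₂ hb₂ r t hr ht hrt => ?_⟩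
  obtain ⟨a₁, ha₁, hv₁⟩ := (hv b₁ hb₁).1
  obtain ⟨a₂, ha₂, hv₂⟩ := (hv b₂ hb₂).1
  rw [← hv₁, ← hv₂]
  exact ((hv _ (hs hb₁ hb₂ hr ht hrt)).2 ⟨_, hL.1 ha₁ ha₂ hr ht hrt, rfl⟩).trans
    (hL.2 ha₁ ha₂ hr ht hrt)

theorem isMinOn_Icc_clamp_of_convexOn (hf : ConvexOn ℝ s f) {β lo hi : ℝ}
    (hβ : β ∈ s) (hmin : IsMinOn f s β) (hsub : Icc lo hi ⊆ s) :
    IsMinOn f (Icc lo hi) (max lo (min β hi)) := by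
  intro a ha
  have hseg : max lo (min β hi) ∈ segment ℝ β a := by
    rw [segment_eq_uIcc, mem_uIcc]
    rcases le_total β lo with hlo | hlo
    · rw [max_eq_left ((min_le_left _ _).trans hlo)]
      exact Or.inl ⟨hlo, ha.1⟩
    rw [max_eq_right (le_min hlo (ha.1.trans ha.2))]
    rcases le_total β hi with hhi | hhi
    · simpa only [min_eq_left hhi, le_refl, true_and, and_true] using le_total β a
    · rw [min_eq_right hhi]
      exact Or.inr ⟨ha.2, hhi⟩
  exact (hf.le_on_segment hβ (hsub ha) hseg).trans_eq (max_eq_right (hmin (hsub ha)))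

end ConvexAnalysis

section TiltMinimizers

/-- The minimizers over `s` of `f` tilted by the linear function of slope `p`. For convex `f` these
are the points of `s` where `-p` is a subgradient of `f` on `s`. -/
def tiltMinimizers (s : Set ℝ) (f : ℝ → ℝ) (p : ℝ) : Set ℝ :=
  {β ∈ s | IsMinOn (fun a => p * a + f a) s β}

variable {s : Set ℝ} {f g : ℝ → ℝ}

theorem tiltMinimizers_congr (hfg : EqOn f g s) (p : ℝ) :
    tiltMinimizers s f p = tiltMinimizers s g p := by
  ext β
  refine and_congr_right fun hβ => forall₂_congr fun a ha => ?_
  simp only [mem_ofPred_eq, hfg hβ, hfg ha]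

theorem le_of_mem_tiltMinimizers_of_lt {p q β γ : ℝ} (hβ : β ∈ tiltMinimizers s f p)
    (hγ : γ ∈ tiltMinimizers s f q) (hpq : p < q) : γ ≤ β := by
  have hβγ : p * β + f β ≤ p * γ + f γ := hβ.2 hγ.1
  have hγβ : q * γ + f γ ≤ q * β + f β := hγ.2 hβ.1
  nlinarith

theorem antitone_of_mem_tiltMinimizers {ι : Type*} [PartialOrder ι] {π τ : ι → ℝ}
    (hπ : StrictMono π) (hτ : ∀ i, τ i ∈ tiltMinimizers s f (π i)) : Antitone τ := fun i j hij =>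
  hij.eq_or_lt.elim (fun h => h ▸ le_rfl)
    fun h => le_of_mem_tiltMinimizers_of_lt (hτ i) (hτ j) (hπ h)

theorem tiltMinimizers_nonempty (hs : IsCompact s) (hne : s.Nonempty) (hf : ContinuousOn f s)
    (p : ℝ) : (tiltMinimizers s f p).Nonempty :=
  hs.exists_isMinOn hne (by fun_prop)

theorem exists_antitone_forall_mem_tiltMinimizers (hs : IsCompact s) (hne : s.Nonempty)
    (hf : ContinuousOn f s) : ∃ τ : ℝ → ℝ, Antitone τ ∧ ∀ p, τ p ∈ tiltMinimizers s f p := by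
  choose τ hτ using tiltMinimizers_nonempty hs hne hf
  exact ⟨τ, antitone_of_mem_tiltMinimizers strictMono_id hτ, hτ⟩

theorem isCompact_tiltMinimizers (hs : IsCompact s) (hf : ContinuousOn f s) (p : ℝ) :
    IsCompact (tiltMinimizers s f p) := by
  obtain hempty | ⟨m, hm⟩ := (tiltMinimizers s f p).eq_empty_or_nonempty
  · exact hempty ▸ isCompact_empty
  have hsublevel : tiltMinimizers s f p = s ∩ (fun a => p * a + f a) ⁻¹' Iic (p * m + f m) := by
    ext β
    refine ⟨fun hβ => ⟨hβ.1, hβ.2 hm.1⟩, fun hβ => ⟨hβ.1, isMinOn_iff.2 fun a ha => ?_⟩⟩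
    exact le_trans hβ.2 (hm.2 ha)
  rw [hsublevel]
  exact hs.of_isClosed_subset (ContinuousOn.preimage_isClosed_of_isClosed (by fun_prop)
    hs.isClosed isClosed_Iic) inter_subset_left

theorem convexOn_mul_add (hf : ConvexOn ℝ s f) (p : ℝ) : ConvexOn ℝ s fun a => p * a + f a :=
  ((LinearMap.mulLeft ℝ p).convexOn hf.1).add hf

theorem ordConnected_tiltMinimizers (hf : ConvexOn ℝ s f) (p : ℝ) :
    (tiltMinimizers s f p).OrdConnected := by
  refine ⟨fun m₁ hm₁ m₂ hm₂ β hβ => ⟨hf.1.ordConnected.out hm₁.1 hm₂.1 hβ, fun a ha => ?_⟩⟩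
  exact ((convexOn_mul_add hf p).le_max_of_mem_Icc hm₁.1 hm₂.1 hβ).trans
    (max_le (hm₁.2 ha) (hm₂.2 ha))

end TiltMinimizers

section DiscountedSums

variable {r A : ℝ} {a : ℕ → ℝ}

theorem summable_pow_mul_of_abs_le (hr₀ : 0 ≤ r) (hr₁ : r < 1) (ha : ∀ n, |a n| ≤ A) :
    Summable fun n => r ^ n * a n := by
  refine .of_norm_bounded ((summable_geometric_of_lt_one hr₀ hr₁).mul_right A) fun n => ?_
  rw [norm_mul, norm_pow, Real.norm_of_nonneg hr₀]
  exact mul_le_mul_of_nonneg_left (ha n) (pow_nonneg hr₀ n)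

theorem hasSum_pow_mul_sub (hr₀ : 0 ≤ r) (hr₁ : r < 1) (ha : ∀ n, |a n| ≤ A) :
    HasSum (fun n => r ^ n * (a n - r * a (n + 1))) (a 0) := by
  have hsum := (summable_pow_mul_of_abs_le hr₀ hr₁ ha).hasSum
  have htail := (hasSum_nat_add_iff' 1).2 hsum
  have heq : ∀ n, r ^ n * (a n - r * a (n + 1)) = r ^ n * a n - r ^ (n + 1) * a (n + 1) :=
    fun n => by ring
  simpa [heq] using hsum.sub htail

end DiscountedSums

section ParametricIntegrals

variable {X : Type*} [MeasurableSpace X]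

theorem convexOn_integral {E : Type*} [AddCommGroup E] [Module ℝ E] {V : X → E → ℝ}
    {μ : Measure X} {s : Set E} (hs : Convex ℝ s) (hV : ∀ x, ConvexOn ℝ s (V x))
    (hint : ∀ b ∈ s, Integrable (fun x => V x b) μ) :
    ConvexOn ℝ s fun b => ∫ x, V x b ∂μ := by
  refine ⟨hs, fun b₁ hb₁ b₂ hb₂ r t hr ht hrt => ?_⟩
  have h₁ : Integrable (fun x => r • V x b₁) μ := (hint b₁ hb₁).smul r
  have h₂ : Integrable (fun x => t • V x b₂) μ := (hint b₂ hb₂).smul t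
  calc ∫ x, V x (r • b₁ + t • b₂) ∂μ ≤ ∫ x, r • V x b₁ + t • V x b₂ ∂μ :=
        integral_mono (hint _ (hs hb₁ hb₂ hr ht hrt)) (h₁.add h₂)
          fun x => (hV x).2 hb₁ hb₂ hr ht hrt
    _ = r • ∫ x, V x b₁ ∂μ + t • ∫ x, V x b₂ ∂μ := by
        rw [integral_add h₁ h₂, integral_smul, integral_smul]

theorem measurable_uncurry_of_continuousOn_Icc {V : X → ℝ → ℝ} {l u : ℝ}
    (hmeas : ∀ b ∈ Icc l u, Measurable fun x => V x b) (hcont : ∀ x, ContinuousOn (V x) (Icc l u)) :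
    Measurable fun q : X × Icc l u => V q.1 q.2 :=
  (measurable_uncurry_of_continuous_of_measurable (u := fun (b : Icc l u) x => V x b)
    (fun x => (hcont x).domRestrict) fun b => hmeas b b.2).comp measurable_swap

end ParametricIntegrals

namespace StorageModel

variable {M : Type*} [MeasurableSpace M] {S : StorageModel M}

/-- A battery without conversion losses, `ηc = ηd = 1`. -/
structure FullyEfficient (S : StorageModel M) : Prop where
  ηc_eq : S.ηc = 1
  ηd_eq : S.ηd = 1

theorem FullyEfficient.stageCost_eq (heff : S.FullyEfficient) (x : S.State) (δ : ℝ) :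
    S.stageCost x δ = (S.demand x + δ) * S.price x := by
  rw [stageCost, heff.ηc_eq, heff.ηd_eq, inv_one, one_mul, one_mul, add_sub_assoc,
    max_zero_sub_eq_self]

theorem continuous_stageCost (x : S.State) : Continuous (S.stageCost x) := by
  unfold stageCost
  fun_prop

theorem exists_stageCost_bound (S : StorageModel M) :
    ∃ C, ∀ x, ∀ b ∈ Icc 0 S.Bmax, ∀ a ∈ Icc 0 S.Bmax, |S.stageCost x (a - b)| ≤ C := by
  obtain ⟨C, hC⟩ := IsCompact.exists_bound_of_continuousOn
    (S.D_compact.prod (S.P_compact.prod ((isCompact_Icc (a := 0) (b := S.Bmax)).prod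
      (isCompact_Icc (a := 0) (b := S.Bmax)))))
    (f := fun q : ℝ × ℝ × ℝ × ℝ => (q.1 + S.ηc⁻¹ * max (q.2.2.2 - q.2.2.1) 0 -
      S.ηd * max (-(q.2.2.2 - q.2.2.1)) 0) * q.2.1) (by fun_prop)
  exact ⟨C, fun x b hb a ha => hC (x.1, x.2.1, b, a) ⟨x.1.2, x.2.1.2, hb, ha⟩⟩

section Control

theorem lowerEnd_le (x : S.State) {b : ℝ} (hb : b ∈ Icc 0 S.Bmax) : S.lowerEnd x b ≤ b :=
  max_le hb.1 (max_le (sub_le_self b (div_nonneg (S.D_nonneg _ x.1.2) S.ηd_mem.1.le))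
    (sub_le_self b (S.Ad_nonneg b hb)))

theorem le_upperEnd {b : ℝ} (hb : b ∈ Icc 0 S.Bmax) : b ≤ S.upperEnd b :=
  le_min hb.2 (le_add_of_nonneg_right (mul_nonneg S.ηc_mem.1.le (S.Ac_nonneg b hb)))

theorem lowerEnd_le_upperEnd (x : S.State) {b : ℝ} (hb : b ∈ Icc 0 S.Bmax) :
    S.lowerEnd x b ≤ S.upperEnd b :=
  (lowerEnd_le x hb).trans (le_upperEnd hb)

theorem control_subset (x : S.State) (b : ℝ) : S.control x b ⊆ Icc 0 S.Bmax :=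
  Icc_subset_Icc (le_max_left _ _) (min_le_left _ _)

/-- The pairs of a current level and a feasible next level in state `x`; `ConvexControl` says that
these sets are convex and closed. -/
def controlGraph (S : StorageModel M) (x : S.State) : Set (ℝ × ℝ) :=
  {q | q.1 ∈ Icc 0 S.Bmax ∧ q.2 ∈ S.control x q.1}

theorem ConvexControl.isCompact_controlGraph (hconv : S.ConvexControl) (x : S.State) :
    IsCompact (S.controlGraph x) :=
  (isCompact_Icc.prod isCompact_Icc).of_isClosed_subset (hconv x).2
    fun _ hq => ⟨hq.1, control_subset x _ hq.2⟩

theorem ConvexControl.continuousOn_lowerEnd (hconv : S.ConvexControl) (x : S.State) :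
    ContinuousOn (S.lowerEnd x) (Icc 0 S.Bmax) :=
  continuousOn_lower_boundary (fun _ => lowerEnd_le_upperEnd x) (hconv x).1
    (hconv.isCompact_controlGraph x)

theorem ConvexControl.continuousOn_upperEnd (hconv : S.ConvexControl) (x : S.State) :
    ContinuousOn S.upperEnd (Icc 0 S.Bmax) :=
  continuousOn_upper_boundary (fun _ => lowerEnd_le_upperEnd x) (hconv x).1
    (hconv.isCompact_controlGraph x)

theorem thresholdAction_eq (x : S.State) (β : ℝ) {b : ℝ} (hb : b ∈ Icc 0 S.Bmax) :
    S.thresholdAction x β β b = max (S.lowerEnd x b) (min β (S.upperEnd b)) := by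
  have hlo := lowerEnd_le x hb
  have hhi := le_upperEnd hb
  rw [thresholdAction]
  split_ifs with hle hge
  · exact (max_eq_right (le_min (hlo.trans hle) (hlo.trans hhi))).symm
  · rw [min_eq_left (hge.trans hhi), max_comm]
  · exact absurd (le_of_not_ge hle) hge

theorem thresholdAction_mem_control (x : S.State) (β : ℝ) {b : ℝ} (hb : b ∈ Icc 0 S.Bmax) :
    S.thresholdAction x β β b ∈ S.control x b := by
  rw [thresholdAction_eq x β hb]
  exact ⟨le_max_left _ _, max_le (lowerEnd_le_upperEnd x hb) (min_le_right _ _)⟩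

theorem ConvexControl.continuousOn_thresholdAction (hconv : S.ConvexControl) (x : S.State)
    (β : ℝ) : ContinuousOn (S.thresholdAction x β β) (Icc 0 S.Bmax) :=
  ((hconv.continuousOn_lowerEnd x).sup
    (continuousOn_const.inf (hconv.continuousOn_upperEnd x))).congr
      fun _ hb => thresholdAction_eq x β hb

end Control

section Measurability

theorem measurable_demand : Measurable S.demand :=
  measurable_subtype_coe.comp measurable_fst

theorem measurable_price : Measurable S.price :=
  measurable_subtype_coe.comp (measurable_fst.comp measurable_snd)

theorem measurable_stageCost : Measurable fun q : S.State × ℝ => S.stageCost q.1 q.2 := by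
  have := measurable_demand (S := S)
  have := measurable_price (S := S)
  unfold stageCost
  fun_prop

theorem measurable_thresholdAction {β : S.State → ℝ} (hβ : Measurable β) {b : ℝ}
    (hb : b ∈ Icc 0 S.Bmax) : Measurable fun x => S.thresholdAction x (β x) (β x) b := by
  have := measurable_demand (S := S)
  simp only [thresholdAction_eq _ _ hb, lowerEnd]
  fun_prop

theorem IIDDemandPrice.integral_eq (hiid : S.IIDDemandPrice) {F : S.State → ℝ}
    (hF : Measurable F)
    (hcongr : ∀ y z, S.demand y = S.demand z → S.price y = S.price z → F y = F z)
    (x x' : S.State) : ∫ y, F y ∂S.κ x = ∫ y, F y ∂S.κ x' := by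
  have hemb : MeasurableEmbedding (Prod.map Subtype.val Subtype.val : S.D × S.P → ℝ × ℝ) :=
    (MeasurableEmbedding.subtype_coe S.D_compact.measurableSet).prodMap
      (.subtype_coe S.P_compact.measurableSet)
  obtain ⟨W, hW, hext⟩ := hemb.exists_measurable_extend
    (g := fun q => F (q.1, q.2, x.2.2)) (by fun_prop) fun _ => inferInstance
  have hFW : F = fun y => W (S.demand y, S.price y) :=
    funext fun y => (hcongr y (y.1, y.2.1, x.2.2) rfl rfl).trans (congrFun hext (y.1, y.2.1)).symm
  have hpair : Measurable fun y : S.State => (S.demand y, S.price y) :=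
    measurable_demand.prodMk measurable_price
  rw [hFW, ← integral_map hpair.aemeasurable hW.aestronglyMeasurable, hiid x x',
    integral_map hpair.aemeasurable hW.aestronglyMeasurable]

end Measurability

section Bellman

/-- Cost of moving from level `b` to level `a` in state `x`, when `f` is the expected cost from the
next slot on as a function of the next level. -/
def lookahead (S : StorageModel M) (f : ℝ → ℝ) (x : S.State) (b a : ℝ) : ℝ :=
  S.stageCost x (a - b) + S.α * f a

/-- The dynamic programming operator: the least cost from level `b` in state `x` when `f` is the
expected cost from the next slot on. -/
def bellman (S : StorageModel M) (f : ℝ → ℝ) (x : S.State) (b : ℝ) : ℝ :=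
  sInf (S.lookahead f x b '' S.control x b)

/-- Levels towards which an efficient battery should be moved at price `p` when the expected cost
from the next slot on is `f`: the price of a unit of energy is balanced against its discounted
future value. -/
abbrev targets (S : StorageModel M) (f : ℝ → ℝ) (p : ℝ) : Set ℝ :=
  tiltMinimizers (Icc 0 S.Bmax) (S.α • f) p

variable {f g : ℝ → ℝ}

theorem FullyEfficient.lookahead_eq (heff : S.FullyEfficient) (f : ℝ → ℝ) (x : S.State)
    (b a : ℝ) : S.lookahead f x b a =
      S.price x * a + (S.α • f) a + (S.demand x - b) * S.price x := by
  rw [lookahead, heff.stageCost_eq, Pi.smul_apply, smul_eq_mul]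
  ring

theorem convexOn_smul_α (hf : ConvexOn ℝ (Icc 0 S.Bmax) f) :
    ConvexOn ℝ (Icc 0 S.Bmax) (S.α • f) :=
  hf.smul S.α_mem.1.le

theorem isLeast_lookahead (heff : S.FullyEfficient) (hf : ConvexOn ℝ (Icc 0 S.Bmax) f)
    {x : S.State} {β b : ℝ} (hβ : β ∈ S.targets f (S.price x)) (hb : b ∈ Icc 0 S.Bmax) :
    IsLeast (S.lookahead f x b '' S.control x b)
      (S.lookahead f x b (S.thresholdAction x β β b)) := by
  refine ⟨mem_image_of_mem _ (thresholdAction_mem_control x β hb), ?_⟩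
  rintro _ ⟨a, ha, rfl⟩
  have hmin := isMinOn_Icc_clamp_of_convexOn (convexOn_mul_add (convexOn_smul_α hf) (S.price x))
    hβ.1 hβ.2 (control_subset x b) ha
  rw [heff.lookahead_eq, heff.lookahead_eq, thresholdAction_eq x β hb]
  exact add_le_add_left hmin _

theorem bellman_eq (heff : S.FullyEfficient) (hf : ConvexOn ℝ (Icc 0 S.Bmax) f)
    {x : S.State} {β b : ℝ} (hβ : β ∈ S.targets f (S.price x)) (hb : b ∈ Icc 0 S.Bmax) :
    S.bellman f x b = S.lookahead f x b (S.thresholdAction x β β b) :=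
  (isLeast_lookahead heff hf hβ hb).csInf_eq

theorem exists_antitone_forall_mem_targets (hcont : ContinuousOn f (Icc 0 S.Bmax)) :
    ∃ τ : ℝ → ℝ, Antitone τ ∧ ∀ p, τ p ∈ S.targets f p :=
  exists_antitone_forall_mem_tiltMinimizers isCompact_Icc (nonempty_Icc.2 S.Bmax_nonneg)
    (hcont.const_smul S.α)

theorem isLeast_bellman (heff : S.FullyEfficient) (hf : ConvexOn ℝ (Icc 0 S.Bmax) f)
    (hcont : ContinuousOn f (Icc 0 S.Bmax)) (x : S.State) {b : ℝ} (hb : b ∈ Icc 0 S.Bmax) :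
    IsLeast (S.lookahead f x b '' S.control x b) (S.bellman f x b) := by
  obtain ⟨τ, -, hτ⟩ := exists_antitone_forall_mem_targets hcont
  rw [bellman_eq heff hf (hτ _) hb]
  exact isLeast_lookahead heff hf (hτ _) hb

theorem bellman_congr_state {x y : S.State} (hdemand : S.demand x = S.demand y)
    (hprice : S.price x = S.price y) (f : ℝ → ℝ) : S.bellman f x = S.bellman f y := by
  have hlookahead : S.lookahead f x = S.lookahead f y := by
    funext b a
    simp only [lookahead, stageCost, hdemand, hprice]
  funext b
  simp only [bellman, hlookahead, control, lowerEnd, hdemand]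

theorem convexOn_lookahead (heff : S.FullyEfficient) (hconv : S.ConvexControl)
    (hf : ConvexOn ℝ (Icc 0 S.Bmax) f) (x : S.State) :
    ConvexOn ℝ (S.controlGraph x) fun q => S.lookahead f x q.1 q.2 := by
  have hflow : ConvexOn ℝ (S.controlGraph x) (S.price x • (LinearMap.snd ℝ ℝ ℝ -
      LinearMap.fst ℝ ℝ ℝ)) := LinearMap.convexOn _ (hconv x).1
  have hfuture : ConvexOn ℝ (S.controlGraph x) fun q => S.α * f q.2 :=
    ((convexOn_smul_α hf).comp_linearMap (LinearMap.snd ℝ ℝ ℝ)).subset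
      (fun _ hq => control_subset x _ hq.2) (hconv x).1
  refine ((hflow.add hfuture).add_const (S.demand x * S.price x)).congr fun q _ => ?_
  simp only [lookahead, heff.stageCost_eq, Pi.add_apply, LinearMap.smul_apply, LinearMap.sub_apply,
    LinearMap.fst_apply, LinearMap.snd_apply, smul_eq_mul]
  ring

theorem convexOn_bellman (heff : S.FullyEfficient) (hconv : S.ConvexControl)
    (hf : ConvexOn ℝ (Icc 0 S.Bmax) f) (hcont : ContinuousOn f (Icc 0 S.Bmax)) (x : S.State) :
    ConvexOn ℝ (Icc 0 S.Bmax) (S.bellman f x) := by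
  refine convexOn_of_isLeast_fiber (convex_Icc _ _) (convexOn_lookahead heff hconv hf x)
    fun b hb => ?_
  obtain ⟨⟨a, ha, hval⟩, hle⟩ := isLeast_bellman heff hf hcont x hb
  refine ⟨⟨a, ⟨hb, ha⟩, hval⟩, ?_⟩
  rintro _ ⟨a', ha', rfl⟩
  exact hle (mem_image_of_mem _ ha'.2)

theorem continuousOn_bellman (heff : S.FullyEfficient) (hconv : S.ConvexControl)
    (hf : ConvexOn ℝ (Icc 0 S.Bmax) f) (hcont : ContinuousOn f (Icc 0 S.Bmax)) (x : S.State) :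
    ContinuousOn (S.bellman f x) (Icc 0 S.Bmax) := by
  obtain ⟨τ, -, hτ⟩ := exists_antitone_forall_mem_targets hcont
  have haction := hconv.continuousOn_thresholdAction x (τ (S.price x))
  have hfuture := hcont.comp haction
    fun b hb => control_subset x b (thresholdAction_mem_control x (τ (S.price x)) hb)
  exact (((continuous_stageCost x).comp_continuousOn (haction.sub continuousOn_id)).add
    (hfuture.const_smul S.α)).congr fun b hb => bellman_eq heff hf (hτ _) hb

theorem measurable_bellman (heff : S.FullyEfficient) (hf : ConvexOn ℝ (Icc 0 S.Bmax) f)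
    (hcont : Continuous f) {b : ℝ} (hb : b ∈ Icc 0 S.Bmax) :
    Measurable fun x => S.bellman f x b := by
  obtain ⟨τ, hanti, hτ⟩ := exists_antitone_forall_mem_targets (S := S) hcont.continuousOn
  have haction := measurable_thresholdAction (hanti.measurable.comp measurable_price) hb
  simp only [bellman_eq heff hf (hτ _) hb]
  exact (measurable_stageCost.comp (measurable_id.prodMk (haction.sub_const b))).add
    ((hcont.measurable.comp haction).const_mul _)

theorem measurable_bellman_uncurry (heff : S.FullyEfficient) (hconv : S.ConvexControl)
    (hf : ConvexOn ℝ (Icc 0 S.Bmax) f) (hcont : Continuous f) :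
    Measurable fun q : S.State × Icc 0 S.Bmax => S.bellman f q.1 q.2 :=
  measurable_uncurry_of_continuousOn_Icc (fun _ hb => measurable_bellman heff hf hcont hb)
    (continuousOn_bellman heff hconv hf hcont.continuousOn)

theorem exists_bellman_bound (heff : S.FullyEfficient) (hf : ConvexOn ℝ (Icc 0 S.Bmax) f)
    (hcont : ContinuousOn f (Icc 0 S.Bmax)) :
    ∃ C, ∀ x, ∀ b ∈ Icc 0 S.Bmax, |S.bellman f x b| ≤ C := by
  obtain ⟨C, hC⟩ := S.exists_stageCost_bound
  obtain ⟨K, hK⟩ := isCompact_Icc.exists_bound_of_continuousOn (hcont.const_smul S.α)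
  refine ⟨C + K, fun x b hb => ?_⟩
  obtain ⟨⟨a, ha, hval⟩, -⟩ := isLeast_bellman heff hf hcont x hb
  rw [← hval]
  have ha' := control_subset x b ha
  exact (abs_add_le _ _).trans (add_le_add (hC x b hb a ha') (hK a ha'))

theorem integrable_bellman (heff : S.FullyEfficient) (hf : ConvexOn ℝ (Icc 0 S.Bmax) f)
    (hcont : Continuous f) (μ : Measure S.State) [IsFiniteMeasure μ] {b : ℝ}
    (hb : b ∈ Icc 0 S.Bmax) : Integrable (fun x => S.bellman f x b) μ := by
  obtain ⟨C, hC⟩ := exists_bellman_bound heff hf hcont.continuousOn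
  exact .of_bound (measurable_bellman heff hf hcont hb).aestronglyMeasurable C
    (ae_of_all _ fun x => hC x b hb)

theorem bellman_le_bellman_add (heff : S.FullyEfficient) (hf : ConvexOn ℝ (Icc 0 S.Bmax) f)
    (hfcont : ContinuousOn f (Icc 0 S.Bmax)) (hg : ConvexOn ℝ (Icc 0 S.Bmax) g)
    (hgcont : ContinuousOn g (Icc 0 S.Bmax)) {c : ℝ} (hfg : ∀ a ∈ Icc 0 S.Bmax, f a ≤ g a + c)
    (x : S.State) {b : ℝ} (hb : b ∈ Icc 0 S.Bmax) :
    S.bellman f x b ≤ S.bellman g x b + S.α * c := by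
  obtain ⟨⟨a, ha, hval⟩, -⟩ := isLeast_bellman heff hg hgcont x hb
  calc S.bellman f x b ≤ S.lookahead f x b a :=
        (isLeast_bellman heff hf hfcont x hb).2 (mem_image_of_mem _ ha)
    _ ≤ S.stageCost x (a - b) + S.α * (g a + c) :=
        add_le_add_right (mul_le_mul_of_nonneg_left (hfg a (control_subset x b ha)) S.α_mem.1.le) _
    _ = S.bellman g x b + S.α * c := by rw [← hval, lookahead]; ring

end Bellman

section FixedPoint

variable {f g : ℝ → ℝ} (μ : Measure S.State)

theorem continuousOn_integral_bellman [IsFiniteMeasure μ] (heff : S.FullyEfficient)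
    (hconv : S.ConvexControl) (hf : ConvexOn ℝ (Icc 0 S.Bmax) f) (hcont : Continuous f) :
    ContinuousOn (fun b => ∫ x, S.bellman f x b ∂μ) (Icc 0 S.Bmax) := by
  obtain ⟨C, hC⟩ := exists_bellman_bound heff hf hcont.continuousOn
  exact continuousOn_of_dominated
    (fun b hb => (measurable_bellman heff hf hcont hb).aestronglyMeasurable)
    (fun b hb => ae_of_all _ fun x => hC x b hb) (integrable_const C)
    (ae_of_all _ fun x => continuousOn_bellman heff hconv hf hcont.continuousOn x)

theorem dist_integral_bellman_le [IsProbabilityMeasure μ] (heff : S.FullyEfficient)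
    (hf : ConvexOn ℝ (Icc 0 S.Bmax) f) (hfcont : Continuous f)
    (hg : ConvexOn ℝ (Icc 0 S.Bmax) g) (hgcont : Continuous g) {c : ℝ}
    (hfg : ∀ a ∈ Icc 0 S.Bmax, dist (f a) (g a) ≤ c) {b : ℝ} (hb : b ∈ Icc 0 S.Bmax) :
    dist (∫ x, S.bellman f x b ∂μ) (∫ x, S.bellman g x b ∂μ) ≤ S.α * c := by
  have hpointwise (x : S.State) : ‖S.bellman f x b - S.bellman g x b‖ ≤ S.α * c := by
    rw [Real.norm_eq_abs, abs_sub_le_iff, sub_le_iff_le_add', sub_le_iff_le_add']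
    refine ⟨bellman_le_bellman_add heff hf hfcont.continuousOn hg hgcont.continuousOn
      (fun a ha => ?_) x hb, bellman_le_bellman_add heff hg hgcont.continuousOn hf
      hfcont.continuousOn (fun a ha => ?_) x hb⟩
    · exact sub_le_iff_le_add'.1 ((abs_sub_le_iff.1 (hfg a ha)).1)
    · exact sub_le_iff_le_add'.1 ((abs_sub_le_iff.1 (hfg a ha)).2)
  rw [dist_eq_norm, ← integral_sub (integrable_bellman heff hf hfcont μ hb)
    (integrable_bellman heff hg hgcont μ hb)]
  simpa using norm_integral_le_of_norm_le_const (μ := μ) (ae_of_all _ hpointwise)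

theorem exists_convexOn_integral_bellman_eq [IsProbabilityMeasure μ] (heff : S.FullyEfficient)
    (hconv : S.ConvexControl) :
    ∃ f : ℝ → ℝ, ConvexOn ℝ (Icc 0 S.Bmax) f ∧ Continuous f ∧
      ∀ b ∈ Icc 0 S.Bmax, ∫ x, S.bellman f x b ∂μ = f b := by
  let extend (f : C(Icc 0 S.Bmax, ℝ)) : ℝ → ℝ := IccExtend S.Bmax_nonneg f
  have hextend (f : C(Icc 0 S.Bmax, ℝ)) : Continuous (extend f) := f.continuous.Icc_extend'
  let K : Set C(Icc 0 S.Bmax, ℝ) := {f | ConvexOn ℝ (Icc 0 S.Bmax) (extend f)}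
  have hK : IsClosed K := isClosed_setOfPred_convexOn.preimage
    (continuous_pi fun b => continuous_eval_const (projIcc 0 S.Bmax S.Bmax_nonneg b))
  have : CompleteSpace K := hK.completeSpace_coe
  have : Nonempty K := ⟨0, convexOn_const (0 : ℝ) (convex_Icc _ _)⟩
  let T : K → K := fun f =>
    ⟨⟨_, (continuousOn_integral_bellman μ heff hconv f.2 (hextend f)).domRestrict⟩,
      (convexOn_integral (convex_Icc _ _)
        (convexOn_bellman heff hconv f.2 (hextend f).continuousOn)
        fun b hb => integrable_bellman heff f.2 (hextend f) μ hb).congr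
          fun b hb => (IccExtend_of_mem S.Bmax_nonneg
            ((Icc 0 S.Bmax).domRestrict fun b => ∫ x, S.bellman (extend f) x b ∂μ) hb).symm⟩
  have hT : ContractingWith ⟨S.α, S.α_mem.1.le⟩ T := by
    refine ⟨S.α_mem.2, LipschitzWith.of_dist_le_mul fun f g => ?_⟩
    refine (ContinuousMap.dist_le (mul_nonneg S.α_mem.1.le dist_nonneg)).2 fun b => ?_
    exact dist_integral_bellman_le μ heff f.2 (hextend f) g.2 (hextend g)
      (fun a _ => ContinuousMap.dist_apply_le_dist _) b.2
  refine ⟨extend hT.fixedPoint, hT.fixedPoint.2, hextend _, fun b hb => ?_⟩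
  have hfixed := DFunLike.congr_fun (congrArg Subtype.val hT.fixedPoint_isFixedPt) ⟨b, hb⟩
  exact hfixed.trans (IccExtend_of_mem S.Bmax_nonneg hT.fixedPoint.1 hb).symm

end FixedPoint

/-- A convex continuous solution of the dynamic programming equation that does not depend on the
state. Only the values of `f` on `[0, Bmax]` matter. -/
structure IsBellmanSolution (S : StorageModel M) (f : ℝ → ℝ) : Prop where
  convexOn : ConvexOn ℝ (Icc 0 S.Bmax) f
  continuous : Continuous f
  integral_bellman : ∀ x, ∀ b ∈ Icc 0 S.Bmax, ∫ y, S.bellman f y b ∂S.κ x = f b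

theorem IIDDemandPrice.exists_isBellmanSolution [Nonempty S.State] (hiid : S.IIDDemandPrice)
    (heff : S.FullyEfficient) (hconv : S.ConvexControl) : ∃ f, S.IsBellmanSolution f := by
  obtain ⟨x₀⟩ := ‹Nonempty S.State›
  obtain ⟨f, hf, hcont, hfix⟩ := exists_convexOn_integral_bellman_eq (S.κ x₀) heff hconv
  refine ⟨f, hf, hcont, fun x b hb => (hiid.integral_eq (measurable_bellman heff hf hcont hb)
    (fun y z hd hp => ?_) x x₀).trans (hfix b hb)⟩
  rw [bellman_congr_state hd hp]

section PathLaw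

instance (x : S.State) : IsProbabilityMeasure (S.pathLaw x) :=
  inferInstanceAs (IsProbabilityMeasure (Kernel.traj (X := fun _ => S.State) _ 0 _))

theorem integral_pathLaw_zero (x : S.State) {F : S.State → ℝ} (hF : Measurable F) :
    ∫ ω, F (ω 0) ∂S.pathLaw x = F x := by
  have hF₀ : Measurable fun u : (i : Finset.Iic 0) → S.State => F (u ⟨0, by simp⟩) :=
    hF.comp (measurable_pi_apply _)
  have hmap := integral_map (μ := S.pathLaw x)
    (Preorder.measurable_frestrictLe (X := fun _ => S.State) 0).aemeasurable
    hF₀.aestronglyMeasurable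
  rw [pathLaw, Kernel.traj_map_frestrictLe_apply, Kernel.partialTraj_self, Kernel.id_apply,
    integral_dirac' _ _ hF₀.stronglyMeasurable] at hmap
  exact hmap.symm

theorem map_pathLaw_frestrictLe_compProd (x : S.State) (n : ℕ) :
    ((S.pathLaw x).map (Preorder.frestrictLe (π := fun _ => S.State) n)) ⊗ₘ
        S.κ.comap (fun u => u ⟨n, by simp⟩) (measurable_pi_apply _) =
      (S.pathLaw x).map fun ω =>
        (Preorder.frestrictLe (π := fun _ => S.State) n ω, ω (n + 1)) := by
  let κ' (n : ℕ) : Kernel ((i : Finset.Iic n) → S.State) S.State :=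
    S.κ.comap (fun u => u ⟨n, by simp⟩) (measurable_pi_apply _)
  refine Eq.trans ?_ (Kernel.partialTraj_compProd_eq_map_traj (X := fun _ => S.State) (κ := κ')
    (Nat.zero_le n) (x₀ := fun _ => x))
  rw [← Kernel.traj_map_frestrictLe_apply]
  rfl

theorem integral_pathLaw_succ {E : Type*} [MeasurableSpace E] [StandardBorelSpace E] [Nonempty E]
    (x : S.State) {n : ℕ} {Y : (ℕ → S.State) → E}
    (hY : Measurable[Filtration.piLE (X := fun _ : ℕ => S.State) n] Y) {F : S.State × E → ℝ}
    (hF : Measurable F) {C : ℝ} (hC : ∀ q, ‖F q‖ ≤ C) :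
    ∫ ω, F (ω (n + 1), Y ω) ∂S.pathLaw x =
      ∫ ω, ∫ y, F (y, Y ω) ∂S.κ (ω n) ∂S.pathLaw x := by
  let history := Preorder.frestrictLe (π := fun _ => S.State) n
  have hhistory : Measurable history := Preorder.measurable_frestrictLe n
  rw [Filtration.piLE_eq_comap_frestrictLe] at hY
  obtain ⟨Z, hZ, rfl⟩ := hY.exists_eq_measurable_comp
  have hFZ : Measurable fun q : ((i : Finset.Iic n) → S.State) × S.State => F (q.2, Z q.1) := by
    fun_prop
  have := Measure.isProbabilityMeasure_map (μ := S.pathLaw x) hhistory.aemeasurable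
  have hfubini := Measure.integral_compProd (μ := (S.pathLaw x).map history)
    (κ := S.κ.comap (fun u => u ⟨n, by simp⟩) (measurable_pi_apply _))
    (.of_bound hFZ.aestronglyMeasurable C (ae_of_all _ fun q => hC (q.2, Z q.1)))
  rw [map_pathLaw_frestrictLe_compProd,
    integral_map (hhistory.prodMk (measurable_pi_apply _)).aemeasurable hFZ.aestronglyMeasurable,
    integral_map hhistory.aemeasurable
      hFZ.stronglyMeasurable.integral_kernel_prod_right'.aestronglyMeasurable] at hfubini
  exact hfubini

end PathLaw

namespace Admissible

variable {b : ℝ} {B : ℕ → (ℕ → S.State) → ℝ}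

theorem mem_Icc (hB : S.Admissible b B) (hb : b ∈ Icc 0 S.Bmax) (n : ℕ) (ω : ℕ → S.State) :
    B n ω ∈ Icc 0 S.Bmax := by
  cases n with
  | zero => rwa [hB.init]
  | succ n => exact control_subset _ _ (hB.feasible n ω)

theorem measurable (hB : S.Admissible b B) (n : ℕ) : Measurable (B n) := by
  cases n with
  | zero => rw [funext hB.init]; exact measurable_const
  | succ n => exact (hB.adapted n).mono (Filtration.le _ n) le_rfl

theorem measurable_stageCost (hB : S.Admissible b B) (n : ℕ) :
    Measurable fun ω => S.stageCost (ω n) (B (n + 1) ω - B n ω) :=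
  StorageModel.measurable_stageCost.comp
    ((measurable_pi_apply n).prodMk ((hB.measurable (n + 1)).sub (hB.measurable n)))

theorem integrable_stageCost (hB : S.Admissible b B) (hb : b ∈ Icc 0 S.Bmax) (x : S.State)
    (n : ℕ) : Integrable (fun ω => S.stageCost (ω n) (B (n + 1) ω - B n ω)) (S.pathLaw x) := by
  obtain ⟨C, hC⟩ := S.exists_stageCost_bound
  exact .of_bound (hB.measurable_stageCost n).aestronglyMeasurable C
    (ae_of_all _ fun ω => hC _ _ (hB.mem_Icc hb _ _) _ (hB.mem_Icc hb _ _))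

theorem hasSum_cost (hB : S.Admissible b B) (hb : b ∈ Icc 0 S.Bmax) (x : S.State) :
    HasSum (fun n => S.α ^ n * ∫ ω, S.stageCost (ω n) (B (n + 1) ω - B n ω) ∂S.pathLaw x)
      (S.cost x B) := by
  obtain ⟨C, hC⟩ := S.exists_stageCost_bound
  have hint (n : ℕ) := (hB.integrable_stageCost hb x n).const_mul (S.α ^ n)
  simp only [← integral_const_mul]
  refine hasSum_integral_of_summable_integral_norm hint ?_
  simp only [norm_mul, norm_pow, integral_const_mul, Real.norm_of_nonneg S.α_mem.1.le]
  refine summable_pow_mul_of_abs_le (A := C) S.α_mem.1.le S.α_mem.2 fun n => ?_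
  simpa using norm_integral_le_of_norm_le_const (μ := S.pathLaw x)
    (f := fun ω => |S.stageCost (ω n) (B (n + 1) ω - B n ω)|) (ae_of_all _ fun ω =>
      (abs_abs _).trans_le (hC _ _ (hB.mem_Icc hb n ω) _ (hB.mem_Icc hb (n + 1) ω)))

variable {f : ℝ → ℝ}

theorem integrable_comp (hB : S.Admissible b B) (hb : b ∈ Icc 0 S.Bmax) (hf : Continuous f)
    (x : S.State) (n : ℕ) : Integrable (fun ω => f (B n ω)) (S.pathLaw x) := by
  obtain ⟨K, hK⟩ := isCompact_Icc.exists_bound_of_continuousOn (hf.continuousOn (s := Icc 0 S.Bmax))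
  exact .of_bound (hf.measurable.comp (hB.measurable n)).aestronglyMeasurable K
    (ae_of_all _ fun ω => hK _ (hB.mem_Icc hb n ω))

theorem integrable_bellman (hB : S.Admissible b B) (hb : b ∈ Icc 0 S.Bmax)
    (heff : S.FullyEfficient) (hconv : S.ConvexControl) (hf : ConvexOn ℝ (Icc 0 S.Bmax) f)
    (hcont : Continuous f) (x : S.State) (n : ℕ) :
    Integrable (fun ω => S.bellman f (ω n) (B n ω)) (S.pathLaw x) := by
  obtain ⟨C, hC⟩ := exists_bellman_bound heff hf hcont.continuousOn
  exact .of_bound ((measurable_bellman_uncurry heff hconv hf hcont).comp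
    ((measurable_pi_apply n).prodMk
      ((hB.measurable n).subtype_mk (h := hB.mem_Icc hb n)))).aestronglyMeasurable C
    (ae_of_all _ fun ω => hC _ _ (hB.mem_Icc hb n ω))

theorem integral_bellman_succ (hB : S.Admissible b B) (hb : b ∈ Icc 0 S.Bmax)
    (heff : S.FullyEfficient) (hconv : S.ConvexControl) (hf : S.IsBellmanSolution f)
    (x : S.State) (n : ℕ) :
    ∫ ω, S.bellman f (ω (n + 1)) (B (n + 1) ω) ∂S.pathLaw x =
      ∫ ω, f (B (n + 1) ω) ∂S.pathLaw x := by
  obtain ⟨C, hC⟩ := exists_bellman_bound heff hf.convexOn hf.continuous.continuousOn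
  have := (measurableSet_Icc (a := 0) (b := S.Bmax)).standardBorel
  have : Nonempty (Icc 0 S.Bmax) := ⟨⟨b, hb⟩⟩
  have hlevel : Measurable[Filtration.piLE (X := fun _ : ℕ => S.State) n]
      fun ω => (⟨B (n + 1) ω, hB.mem_Icc hb (n + 1) ω⟩ : Icc 0 S.Bmax) :=
    (hB.adapted n).subtype_mk
  refine (integral_pathLaw_succ x hlevel
    (measurable_bellman_uncurry heff hconv hf.convexOn hf.continuous)
    fun q => hC q.1 q.2 q.2.2).trans ?_
  exact integral_congr_ae (ae_of_all _ fun ω =>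
    hf.integral_bellman (ω n) _ (hB.mem_Icc hb (n + 1) ω))

theorem integral_lookahead_sub_bellman (hB : S.Admissible b B) (hb : b ∈ Icc 0 S.Bmax)
    (heff : S.FullyEfficient) (hconv : S.ConvexControl) (hf : S.IsBellmanSolution f)
    (x : S.State) (n : ℕ) :
    ∫ ω, S.lookahead f (ω n) (B n ω) (B (n + 1) ω) - S.bellman f (ω n) (B n ω) ∂S.pathLaw x =
      ∫ ω, S.stageCost (ω n) (B (n + 1) ω - B n ω) ∂S.pathLaw x -
        (∫ ω, S.bellman f (ω n) (B n ω) ∂S.pathLaw x -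
          S.α * ∫ ω, S.bellman f (ω (n + 1)) (B (n + 1) ω) ∂S.pathLaw x) := by
  have hcost := hB.integrable_stageCost hb x n
  have hfuture := (hB.integrable_comp hb hf.continuous x (n + 1)).const_mul S.α
  have hvalue := hB.integrable_bellman hb heff hconv hf.convexOn hf.continuous x n
  rw [hB.integral_bellman_succ hb heff hconv hf, ← integral_const_mul, sub_sub_eq_add_sub,
    ← integral_add hcost hfuture]
  exact integral_sub (hcost.add hfuture) hvalue

theorem hasSum_cost_sub_bellman (hB : S.Admissible b B) (hb : b ∈ Icc 0 S.Bmax)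
    (heff : S.FullyEfficient) (hconv : S.ConvexControl) (hf : S.IsBellmanSolution f)
    (x : S.State) :
    HasSum (fun n => S.α ^ n * ∫ ω, S.lookahead f (ω n) (B n ω) (B (n + 1) ω) -
      S.bellman f (ω n) (B n ω) ∂S.pathLaw x) (S.cost x B - S.bellman f x b) := by
  obtain ⟨C, hC⟩ := exists_bellman_bound heff hf.convexOn hf.continuous.continuousOn
  have hvalue (n : ℕ) : |∫ ω, S.bellman f (ω n) (B n ω) ∂S.pathLaw x| ≤ C := by
    simpa using norm_integral_le_of_norm_le_const (μ := S.pathLaw x)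
      (f := fun ω => S.bellman f (ω n) (B n ω)) (ae_of_all _ fun ω => hC _ _ (hB.mem_Icc hb n ω))
  have hinit : ∫ ω, S.bellman f (ω 0) (B 0 ω) ∂S.pathLaw x = S.bellman f x b := by
    simp only [hB.init]
    exact integral_pathLaw_zero x (measurable_bellman heff hf.convexOn hf.continuous hb)
  have htelescope := hasSum_pow_mul_sub S.α_mem.1.le S.α_mem.2 hvalue
  rw [hinit] at htelescope
  simp only [hB.integral_lookahead_sub_bellman hb heff hconv hf, mul_sub] at htelescope ⊢
  exact (hB.hasSum_cost hb x).sub htelescope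

theorem bellman_le_cost (hB : S.Admissible b B) (hb : b ∈ Icc 0 S.Bmax)
    (heff : S.FullyEfficient) (hconv : S.ConvexControl) (hf : S.IsBellmanSolution f)
    (x : S.State) : S.bellman f x b ≤ S.cost x B := by
  refine sub_nonneg.1 ((hB.hasSum_cost_sub_bellman hb heff hconv hf x).nonneg fun n =>
    mul_nonneg (pow_nonneg S.α_mem.1.le n) (integral_nonneg fun ω => sub_nonneg.2 ?_))
  exact (isLeast_bellman heff hf.convexOn hf.continuous.continuousOn (ω n) (hB.mem_Icc hb n ω)).2
    (mem_image_of_mem _ (hB.feasible n ω))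

theorem cost_eq_bellman (hB : S.Admissible b B) (hb : b ∈ Icc 0 S.Bmax)
    (heff : S.FullyEfficient) (hconv : S.ConvexControl) (hf : S.IsBellmanSolution f)
    (hgreedy : ∀ n ω, S.lookahead f (ω n) (B n ω) (B (n + 1) ω) = S.bellman f (ω n) (B n ω))
    (x : S.State) : S.cost x B = S.bellman f x b := by
  have hsum := hB.hasSum_cost_sub_bellman hb heff hconv hf x
  simp only [hgreedy, sub_self, integral_zero, mul_zero] at hsum
  exact sub_eq_zero.1 (hsum.unique hasSum_zero)

end Admissible

section Verification

variable {b : ℝ} {β : S.State → ℝ} {f : ℝ → ℝ}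

theorem thresholdPath_mem_Icc (β : S.State → ℝ) (hb : b ∈ Icc 0 S.Bmax) (n : ℕ)
    (ω : ℕ → S.State) : S.thresholdPath β β b n ω ∈ Icc 0 S.Bmax := by
  induction n with
  | zero => exact hb
  | succ n ih => exact control_subset _ _ (thresholdAction_mem_control _ _ ih)

theorem measurable_thresholdPath_succ (hconv : S.ConvexControl) (hβ : Measurable β)
    (hb : b ∈ Icc 0 S.Bmax) (n : ℕ) :
    Measurable[Filtration.piLE (X := fun _ : ℕ => S.State) n]
      (S.thresholdPath β β b (n + 1)) := by
  have hstate (n : ℕ) : Measurable[Filtration.piLE (X := fun _ : ℕ => S.State) n]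
      fun ω : ℕ → S.State => ω n := by
    rw [Filtration.piLE_eq_comap_frestrictLe]
    exact Measurable.comp (g := fun u : (i : Finset.Iic n) → S.State => u ⟨n, by simp⟩)
      (measurable_pi_apply _) (comap_measurable _)
  have haction : Measurable fun q : S.State × Icc 0 S.Bmax =>
      S.thresholdAction q.1 (β q.1) (β q.1) q.2 :=
    measurable_uncurry_of_continuousOn_Icc (V := fun x => S.thresholdAction x (β x) (β x))
      (fun _ => measurable_thresholdAction hβ) fun x => hconv.continuousOn_thresholdAction x (β x)
  have hstep (n : ℕ) (hn : Measurable[Filtration.piLE (X := fun _ : ℕ => S.State) n]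
      (S.thresholdPath β β b n)) : Measurable[Filtration.piLE (X := fun _ : ℕ => S.State) n]
      (S.thresholdPath β β b (n + 1)) :=
    haction.comp ((hstate n).prodMk (hn.subtype_mk (h := thresholdPath_mem_Icc β hb n)))
  induction n with
  | zero => exact hstep 0 measurable_const
  | succ n ih => exact hstep _ (ih.mono (Filtration.mono _ n.le_succ) le_rfl)

theorem admissible_thresholdPath (hconv : S.ConvexControl) (hβ : Measurable β)
    (hb : b ∈ Icc 0 S.Bmax) : S.Admissible b (S.thresholdPath β β b) where
  init _ := rfl
  adapted := measurable_thresholdPath_succ hconv hβ hb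
  feasible n ω := thresholdAction_mem_control _ _ (thresholdPath_mem_Icc β hb n ω)

theorem cost_thresholdPath (heff : S.FullyEfficient) (hconv : S.ConvexControl)
    (hf : S.IsBellmanSolution f) (hβ : Measurable β)
    (htarget : ∀ y, β y ∈ S.targets f (S.price y)) (x : S.State) (hb : b ∈ Icc 0 S.Bmax) :
    S.cost x (S.thresholdPath β β b) = S.bellman f x b :=
  (admissible_thresholdPath hconv hβ hb).cost_eq_bellman hb heff hconv hf (fun n ω =>
    (bellman_eq heff hf.convexOn (htarget (ω n)) (thresholdPath_mem_Icc β hb n ω)).symm) x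

theorem isOptimal_thresholdPath (heff : S.FullyEfficient) (hconv : S.ConvexControl)
    (hf : S.IsBellmanSolution f) (hβ : Measurable β)
    (htarget : ∀ y, β y ∈ S.targets f (S.price y)) (x : S.State) (hb : b ∈ Icc 0 S.Bmax) :
    S.IsOptimal x b (S.thresholdPath β β b) :=
  ⟨admissible_thresholdPath hconv hβ hb, fun _ hB =>
    (cost_thresholdPath heff hconv hf hβ htarget x hb).trans_le
      (hB.bellman_le_cost hb heff hconv hf x)⟩

theorem IsOptimal.J_eq {x : S.State} {B : ℕ → (ℕ → S.State) → ℝ} (hB : S.IsOptimal x b B) :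
    S.J x b = S.cost x B :=
  IsLeast.csInf_eq ⟨⟨B, hB.1, rfl⟩, fun _ ⟨B', hB', hc⟩ => hc ▸ hB.2 B' hB'⟩

theorem IsBellmanSolution.J_eq_bellman (hf : S.IsBellmanSolution f) (heff : S.FullyEfficient)
    (hconv : S.ConvexControl) (x : S.State) (hb : b ∈ Icc 0 S.Bmax) :
    S.J x b = S.bellman f x b := by
  obtain ⟨τ, hanti, hτ⟩ := exists_antitone_forall_mem_targets (S := S) hf.continuous.continuousOn
  have hmeas := hanti.measurable.comp (measurable_price (S := S))
  exact (isOptimal_thresholdPath heff hconv hf hmeas (fun y => hτ _) x hb).J_eq.trans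
    (cost_thresholdPath heff hconv hf hmeas (fun y => hτ _) x hb)

theorem IsBellmanSolution.eqOn_G (hf : S.IsBellmanSolution f) (heff : S.FullyEfficient)
    (hconv : S.ConvexControl) (x : S.State) : EqOn (S.G x) f (Icc 0 S.Bmax) := fun b hb => by
  simp only [G, hf.J_eq_bellman heff hconv _ hb, hf.integral_bellman x b hb]

end Verification

section Thresholds

variable {x : S.State} {p β g m : ℝ}

theorem mem_targets_G_iff :
    β ∈ S.targets (S.G x) p ↔ β ∈ Icc 0 S.Bmax ∧ -p / S.α ∈ S.subdiffG x β := by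
  refine and_congr_right fun _ => forall₂_congr fun a _ => ?_
  have hα := S.α_mem.1
  have hscale : S.α * (S.G x β + -p / S.α * (a - β)) = S.α * S.G x β - p * (a - β) := by
    field_simp
    ring
  rw [← mul_le_mul_iff_right₀ (b := S.G x β + _) hα, hscale]
  simp only [mem_ofPred_eq, Pi.smul_apply, smul_eq_mul]
  constructor <;> intro h <;> linarith

theorem mem_targets_G_of_mem_subdiffG (hm : m ∈ S.targets (S.G x) p) (hβ : β ∈ Icc 0 S.Bmax)
    (hg : g ∈ S.subdiffG x β) (htowards : 0 ≤ (p + S.α * g) * (m - β)) :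
    β ∈ S.targets (S.G x) p := by
  refine ⟨hβ, isMinOn_iff.2 fun a ha => le_trans ?_ (hm.2 ha)⟩
  have hsub := mul_le_mul_of_nonneg_left (hg m hm.1) S.α_mem.1.le
  simp only [Pi.smul_apply, smul_eq_mul]
  linarith

theorem isLeast_setOne (hm : IsLeast (S.targets (S.G x) p) m) : IsLeast (S.setOne x p) m := by
  refine ⟨⟨hm.1.1, _, (mem_targets_G_iff.1 hm.1).2, ?_⟩, ?_⟩
  · rw [mul_div_cancel₀ _ S.α_mem.1.ne', add_neg_cancel]
  · rintro β ⟨hβ, g, hg, hge⟩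
    by_contra! hlt
    exact hlt.not_ge (hm.2 (mem_targets_G_of_mem_subdiffG hm.1 hβ hg
      (mul_nonneg hge (sub_pos.2 hlt).le)))

theorem isGreatest_setTwo (hm : IsGreatest (S.targets (S.G x) p) m) :
    IsGreatest (S.setTwo x p) m := by
  refine ⟨⟨hm.1.1, _, (mem_targets_G_iff.1 hm.1).2, ?_⟩, ?_⟩
  · rw [mul_div_cancel₀ _ S.α_mem.1.ne', add_neg_cancel]
  · rintro β ⟨hβ, g, hg, hle⟩
    by_contra! hlt
    exact hlt.not_ge (hm.2 (mem_targets_G_of_mem_subdiffG hm.1 hβ hg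
      (mul_nonneg_of_nonpos_of_nonpos hle (sub_neg.2 hlt).le)))

theorem Icc_endOne_endTwo (hconvex : ConvexOn ℝ (Icc 0 S.Bmax) (S.G x))
    (hcont : ContinuousOn (S.G x) (Icc 0 S.Bmax)) (p : ℝ) :
    Icc (S.endOne x p) (S.endTwo x p) = S.targets (S.G x) p := by
  have hcompact := isCompact_tiltMinimizers isCompact_Icc (hcont.const_smul S.α) p
  have hne := tiltMinimizers_nonempty isCompact_Icc (nonempty_Icc.2 S.Bmax_nonneg)
    (hcont.const_smul S.α) p
  obtain ⟨m₁, h₁⟩ := hcompact.exists_isLeast hne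
  obtain ⟨m₂, h₂⟩ := hcompact.exists_isGreatest hne
  have hone := isLeast_setOne h₁
  have htwo := isGreatest_setTwo h₂
  rw [endOne, if_pos hone.nonempty, hone.csInf_eq, endTwo, if_pos htwo.nonempty, htwo.csSup_eq]
  exact Subset.antisymm ((ordConnected_tiltMinimizers (convexOn_smul_α hconvex) p).out h₁.1 h₂.1)
    fun β hβ => ⟨h₁.2 hβ, h₂.2 hβ⟩

theorem FullyEfficient.isThreshold_iff (heff : S.FullyEfficient)
    (hconvex : ConvexOn ℝ (Icc 0 S.Bmax) (S.G x))
    (hcont : ContinuousOn (S.G x) (Icc 0 S.Bmax)) :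
    S.IsThreshold x β ↔ β ∈ S.targets (S.G x) (S.price x) := by
  simp only [IsThreshold, chargingThresholds, dischargingThresholds, heff.ηc_eq, heff.ηd_eq,
    inv_one, one_mul, and_self, Icc_endOne_endTwo hconvex hcont]

theorem IsBellmanSolution.isThreshold_iff {f : ℝ → ℝ} (hf : S.IsBellmanSolution f)
    (heff : S.FullyEfficient) (hconv : S.ConvexControl) :
    S.IsThreshold x β ↔ β ∈ S.targets f (S.price x) := by
  have hG := hf.eqOn_G heff hconv x
  rw [heff.isThreshold_iff (hf.convexOn.congr hG.symm) (hf.continuous.continuousOn.congr hG)]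
  exact iff_of_eq (congrArg (β ∈ ·) (tiltMinimizers_congr (fun a ha => by simp [hG ha]) _))

end Thresholds

end StorageModel

end

theorem proposition3 {M : Type*} [MeasurableSpace M] [Nonempty M] (S : StorageModel M)
    (hηc : S.ηc = 1) (hηd : S.ηd = 1) (hiid : S.IIDDemandPrice) (hconv : S.ConvexControl) :
    (∀ x : S.State, ∃ β : ℝ, S.IsThreshold x β) ∧
    (∀ x y : S.State, S.price x = S.price y →
      ∀ β : ℝ, S.IsThreshold x β ↔ S.IsThreshold y β) ∧
    (∀ β : S.P → ℝ, (∀ x : S.State, S.IsThreshold x (β x.2.1)) →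
      Antitone β ∧
      ∀ x : S.State, ∀ b ∈ Icc 0 S.Bmax,
        S.IsOptimal x b (S.thresholdPath (fun y => β y.2.1) (fun y => β y.2.1) b)) := by
  have heff : S.FullyEfficient := ⟨hηc, hηd⟩
  obtain ⟨⟨d, hd⟩, ⟨p₀, hp₀⟩, ⟨m⟩⟩ := S.D_nonempty, S.P_nonempty, ‹Nonempty M›
  have : Nonempty S.State := ⟨(⟨d, hd⟩, ⟨p₀, hp₀⟩, m)⟩
  obtain ⟨f, hf⟩ := hiid.exists_isBellmanSolution heff hconv
  simp only [hf.isThreshold_iff heff hconv]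
  refine ⟨fun x => ?_, fun x y hxy β => by rw [hxy], fun β hβ => ?_⟩
  · exact tiltMinimizers_nonempty isCompact_Icc (nonempty_Icc.2 S.Bmax_nonneg)
      (hf.continuous.continuousOn.const_smul S.α) (S.price x)
  have hanti : Antitone β := antitone_of_mem_tiltMinimizers (π := Subtype.val)
    (Subtype.strictMono_coe S.P) fun p => hβ (⟨d, hd⟩, p, m)
  have hmeas : Measurable fun y : S.State => β y.2.1 :=
    hanti.measurable.comp (measurable_fst.comp measurable_snd)
  exact ⟨hanti, fun x b hb => StorageModel.isOptimal_thresholdPath heff hconv hf hmeas hβ x hb⟩
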